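/- Let $n\ge 1$. A source $\boldsymbol m\sim\mathcal N(0,\sigma_m^2 I_n)$ and a channel noise $\boldsymbol w\sim\mathcal N(0,\sigma_w^2 I_n)$ are independent, with $\sigma_m,\sigma_w>0$. The encoder chooses a Borel map $\gamma^{\mathrm e}:\mathbb R^n\to\mathbb R^n$ and sends $\boldsymbol x=\gamma^{\mathrm e}(\boldsymbol m)$; the decoder observes $\boldsymbol y=\boldsymbol x+\boldsymbol w$, chooses a Borel map $\gamma^{\mathrm d}:\mathbb R^n\to\mathbb R^n$ and forms $\boldsymbol u=\gamma^{\mathrm d}(\boldsymbol y)$. For $a\in\mathbb R$, $\boldsymbol b\in\mathbb R^n$ and $\rho>0$ the expected costs are $$J^{\mathrm d}(\gamma^{\mathrm e},\gamma^{\mathrm d})=\mathbb E\|\boldsymbol m-\boldsymbol u\|^2,\qquad J^{\mathrm e}(\gamma^{\mathrm e},\gamma^{\mathrm d})=\mathbb E\big[\|a\boldsymbol m-\boldsymbol b-\boldsymbol u\|^2+\rho\|\boldsymbol x\|^2\big],$$ with values in $[0,\infty]$. A pair $(\gamma^{\mathrm e},\gamma^{\mathrm d})$ is a Stackelberg equilibrium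 if $\gamma^{\mathrm d}$ is a best response to $\gamma^{\mathrm e}$, i.e. it minimizes $J^{\mathrm d}(\gamma^{\mathrm e},\cdot)$ over all Borel maps, and $J^{\mathrm e}(\gamma^{\mathrm e},\gamma^{\mathrm d})\le J^{\mathrm e}(\tilde\gamma^{\mathrm e},\tilde\gamma^{\mathrm d})$ for every Borel map $\tilde\gamma^{\mathrm e}$ and every best response $\tilde\gamma^{\mathrm d}$ to $\tilde\gamma^{\mathrm e}$. It is affine if both $\gamma^{\mathrm e}$ and $\gamma^{\mathrm d}$ are affine maps, and informative if $\boldsymbol m$ and $\boldsymbol x$ are not independent. Then an informative affine Stackelberg equilibrium exists if and only if $$\rho<(2a-1)\frac{\sigma_m^2}{\sigma_w^2},$$ and the same condition is also necessary and sufficient for the existence of an informative Stackelberg equilibrium, affine or not. -/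

import Mathlib

open MeasureTheory ProbabilityTheory
open scoped ENNReal

/-- Data of the `n`-dimensional Gaussian signaling game with linear bias: the covariances of source
and channel noise, the sensitivity matrix `A`, the additive bias `b` and the power weight `ρ`. -/
structure SignalingGame (n : ℕ) where
  /-- covariance `Σ_m` of the source -/
  sourceCov : Matrix (Fin n) (Fin n) ℝ
  sourceCov_posDef : sourceCov.PosDef
  /-- covariance `Σ_w` of the channel noise -/
  noiseCov : Matrix (Fin n) (Fin n) ℝ
  noiseCov_posSemidef : noiseCov.PosSemidef
  /-- sensitivity matrix `A` in the encoder's cost -/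
  A : Matrix (Fin n) (Fin n) ℝ
  /-- additive bias in the encoder's cost -/
  b : EuclideanSpace ℝ (Fin n)
  /-- weight of the transmission power in the encoder's cost -/
  ρ : ℝ
  ρ_nonneg : 0 ≤ ρ

namespace SignalingGame

variable {n : ℕ} (G : SignalingGame n)

/-- Joint law of `(m, w)`: independent centred Gaussian vectors with covariances `Σ_m`, `Σ_w`. -/
noncomputable def law : Measure (EuclideanSpace ℝ (Fin n) × EuclideanSpace ℝ (Fin n)) :=
  (multivariateGaussian 0 G.sourceCov).prod (multivariateGaussian 0 G.noiseCov)

/-- Decoder's instantaneous cost `‖m - u‖²`. -/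
noncomputable def decoderInstCost (m u : EuclideanSpace ℝ (Fin n)) : ℝ := ‖m - u‖ ^ 2

/-- Encoder's instantaneous cost `‖A m - b - u‖² + ρ ‖x‖²`. -/
noncomputable def encoderInstCost (m x u : EuclideanSpace ℝ (Fin n)) : ℝ :=
  ‖Matrix.toEuclideanCLM (𝕜 := ℝ) G.A m - G.b - u‖ ^ 2 + G.ρ * ‖x‖ ^ 2

/-- Decoder's expected cost, with values in `[0, ∞]`. The sample point is `z = (m, w)`, the message
is `x = γe m`, the channel output is `y = x + w` and the estimate is `u = γd y`. -/
noncomputable def decoderCost (γe γd : EuclideanSpace ℝ (Fin n) → EuclideanSpace ℝ (Fin n)) :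
    ℝ≥0∞ :=
  ∫⁻ z, ENNReal.ofReal (decoderInstCost z.1 (γd (γe z.1 + z.2))) ∂G.law

/-- Encoder's expected cost, with values in `[0, ∞]`. -/
noncomputable def encoderCost (γe γd : EuclideanSpace ℝ (Fin n) → EuclideanSpace ℝ (Fin n)) :
    ℝ≥0∞ :=
  ∫⁻ z, ENNReal.ofReal (G.encoderInstCost z.1 (γe z.1) (γd (γe z.1 + z.2))) ∂G.law

/-- `γd` is a best response of the decoder to `γe` among all Borel measurable policies. -/
def IsBestResponse (γe γd : EuclideanSpace ℝ (Fin n) → EuclideanSpace ℝ (Fin n)) : Prop :=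
  Measurable γd ∧ ∀ γd' : EuclideanSpace ℝ (Fin n) → EuclideanSpace ℝ (Fin n),
    Measurable γd' → G.decoderCost γe γd ≤ G.decoderCost γe γd'

/-- `(γe, γd)` is a Stackelberg equilibrium with the encoder as leader: the decoder best responds,
and no Borel measurable encoder policy, followed by the best response to it, costs the encoder less.
(A best response always exists and is unique up to almost sure equality of the estimates, so it does
not matter which one is taken.) -/
def IsStackelbergEquilibrium
    (γe γd : EuclideanSpace ℝ (Fin n) → EuclideanSpace ℝ (Fin n)) : Prop :=
  Measurable γe ∧ G.IsBestResponse γe γd ∧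
    ∀ γe' γd' : EuclideanSpace ℝ (Fin n) → EuclideanSpace ℝ (Fin n),
      Measurable γe' → G.IsBestResponse γe' γd' → G.encoderCost γe γd ≤ G.encoderCost γe' γd'

/-- The encoder policy `γe` is informative: the source `m` and the message `x = γe m` are not
independent. -/
def IsInformative (γe : EuclideanSpace ℝ (Fin n) → EuclideanSpace ℝ (Fin n)) : Prop :=
  ¬ IndepFun (fun z : EuclideanSpace ℝ (Fin n) × EuclideanSpace ℝ (Fin n) => z.1)
    (fun z => γe z.1) G.law

end SignalingGame

/-- The policy `γ` is an affine map `v ↦ K v + c`. -/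
def IsAffinePolicy {n : ℕ} (γ : EuclideanSpace ℝ (Fin n) → EuclideanSpace ℝ (Fin n)) : Prop :=
  ∃ (K : Matrix (Fin n) (Fin n) ℝ) (c : EuclideanSpace ℝ (Fin n)),
    ∀ v, γ v = Matrix.toEuclideanCLM (𝕜 := ℝ) K v + c

/-! A best-response error is orthogonal to every square integrable function of the channel output,
constants included. Hence the bias `b` only shifts the encoder's cost, which becomes const +
n((2a-1)D + ρp), with D the distortion and p the power per coordinate
(`IsBestResponse.encoderCost_eq`).

By `distortion_lower_bound`, D ≥ vm vw/(vw + p), with vm, vw the source and noise variances; linear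
policies attain equality. For 2a-1 > 0 the game thus reduces to minimizing the convex function
(2a-1) vm vw/(vw + p) + ρp over p ≥ 0. Its slope at 0 is ρ - (2a-1) vm/vw, so the minimizer is
positive exactly under the stated condition. Otherwise, also when 2a-1 ≤ 0, only p = 0 is optimal,
and the message is almost surely 0.

The distortion bound needs no mutual information: a likelihood ratio exp T integrates to 1, and 1 +
T ≤ exp T gives E T ≤ 0, which is the bound. -/

/-- The density of the centred Gaussian measure with covariance `v • 1`. -/
noncomputable def isotropicGaussianPDF {n : ℕ} (v : ℝ) (x : EuclideanSpace ℝ (Fin n)) : ℝ :=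
  ((2 * Real.pi * v) ^ (n / 2 : ℝ))⁻¹ * Real.exp (-(2 * v)⁻¹ * ‖x‖ ^ 2)

/-! ### Isotropic Gaussian measures: density and second moment -/

section IsotropicGaussian

variable {n : ℕ} {v : ℝ}

local notation "E" => EuclideanSpace ℝ (Fin n)

@[fun_prop]
lemma continuous_isotropicGaussianPDF : Continuous (isotropicGaussianPDF v : E → ℝ) := by
  unfold isotropicGaussianPDF; fun_prop

lemma isotropicGaussianPDF_nonneg (hv : 0 < v) (x : E) : 0 ≤ isotropicGaussianPDF v x := by
  unfold isotropicGaussianPDF; positivity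

lemma posSemidef_smul_one (hv : 0 < v) : (v • (1 : Matrix (Fin n) (Fin n) ℝ)).PosSemidef :=
  Matrix.PosSemidef.one.smul hv.le

lemma integral_isotropicGaussianPDF (hv : 0 < v) :
    ∫ x : E, isotropicGaussianPDF v x = 1 := by
  unfold isotropicGaussianPDF
  rw [integral_const_mul, GaussianFourier.integral_rexp_neg_mul_sq_norm (by positivity)]
  have : Real.pi / (2 * v)⁻¹ = 2 * Real.pi * v := by field_simp
  rw [this, finrank_euclideanSpace_fin, inv_mul_cancel₀ (by positivity)]

lemma integrable_isotropicGaussianPDF (hv : 0 < v) :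
    Integrable (isotropicGaussianPDF v : E → ℝ) := by
  by_contra h
  simpa [integral_undef h] using integral_isotropicGaussianPDF (n := n) hv

lemma lintegral_isotropicGaussianPDF (hv : 0 < v) :
    ∫⁻ x : E, ENNReal.ofReal (isotropicGaussianPDF v x) = 1 := by
  rw [← ofReal_integral_eq_lintegral_ofReal (integrable_isotropicGaussianPDF hv)
    (ae_of_all _ (isotropicGaussianPDF_nonneg hv)), integral_isotropicGaussianPDF hv]
  simp

/-- Both measures have the same characteristic function. The density form permits the Lebesgue
changes of variables in the likelihood ratio computation. -/
lemma multivariateGaussian_smul_one_eq_withDensity (hv : 0 < v) :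
    multivariateGaussian (0 : E) (v • 1) =
      volume.withDensity (fun x => ENNReal.ofReal (isotropicGaussianPDF v x)) := by
  have hfin : IsFiniteMeasure
      (volume.withDensity fun x : E => ENNReal.ofReal (isotropicGaussianPDF v x)) :=
    isFiniteMeasure_withDensity_ofReal (integrable_isotropicGaussianPDF hv).2
  refine Measure.ext_of_charFun ?_
  ext t
  rw [charFun_multivariateGaussian (posSemidef_smul_one hv), charFun_apply,
    integral_withDensity_eq_integral_toReal_smul (by fun_prop) (ae_of_all _ (by simp))]
  have key := GaussianFourier.integral_cexp_neg_mul_sq_norm_add (V := E)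
    (b := (((2 * v)⁻¹ : ℝ) : ℂ)) (by simpa using hv) Complex.I t
  have hint : ∀ x : E, (ENNReal.ofReal (isotropicGaussianPDF v x)).toReal •
      Complex.exp (inner ℝ x t * Complex.I) = ((((2 * Real.pi * v) ^ (n / 2 : ℝ))⁻¹ : ℝ) : ℂ) *
      Complex.exp (-(((2 * v)⁻¹ : ℝ) : ℂ) * ‖x‖ ^ 2 + Complex.I * inner ℝ t x) := by
    intro x
    rw [ENNReal.toReal_ofReal (isotropicGaussianPDF_nonneg hv x), isotropicGaussianPDF,
      Complex.real_smul, Complex.exp_add, real_inner_comm]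
    push_cast
    ring_nf
  simp_rw [hint]
  rw [integral_const_mul, key]
  have hpi : (Real.pi : ℂ) / (((2 * v)⁻¹ : ℝ) : ℂ) = ((2 * Real.pi * v : ℝ) : ℂ) := by
    push_cast; field_simp
  have hpow : ((2 * Real.pi * v : ℝ) : ℂ) ^ ((Module.finrank ℝ E : ℂ) / 2) =
      (((2 * Real.pi * v) ^ (n / 2 : ℝ) : ℝ) : ℂ) := by
    rw [Complex.ofReal_cpow (by positivity)]
    simp
  rw [hpi, hpow, ← mul_assoc, ← Complex.ofReal_mul, inv_mul_cancel₀ (by positivity)]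
  have hdot : (WithLp.ofLp t) ⬝ᵥ (WithLp.ofLp t) = ‖t‖ ^ 2 := by
    rw [EuclideanSpace.real_norm_sq_eq]
    simp [dotProduct, sq]
  simp only [inner_zero_right, Complex.ofReal_zero, zero_mul, zero_sub, Complex.ofReal_one, one_mul,
    Matrix.smul_mulVec, Matrix.one_mulVec, dotProduct_smul, hdot, Complex.I_sq]
  congr 1
  push_cast
  have : (v : ℂ) ≠ 0 := by exact_mod_cast hv.ne'
  simp only [smul_eq_mul]
  push_cast
  field_simp
  ring

lemma integral_norm_sq_multivariateGaussian_smul_one (hv : 0 < v) :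
    ∫ x, ‖x‖ ^ 2 ∂(multivariateGaussian (0 : E) (v • 1)) = n * v := by
  have hmem : MemLp (id : E → E) 2 (multivariateGaussian (0 : E) (v • 1)) :=
    IsGaussian.memLp_two_id
  have hcoord : ∀ i : Fin n, MemLp (fun x : E => x i) 2 (multivariateGaussian (0 : E) (v • 1)) :=
    fun i => hmem.continuousLinearMap_comp (EuclideanSpace.proj i : E →L[ℝ] ℝ)
  simp_rw [EuclideanSpace.real_norm_sq_eq]
  rw [integral_finsetSum _ fun i _ => (hcoord i).integrable_sq]
  have : ∀ i : Fin n, ∫ x : E, (x i) ^ 2 ∂(multivariateGaussian (0 : E) (v • 1)) = v := by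
    intro i
    have h0 : ∫ x : E, x i ∂(multivariateGaussian (0 : E) (v • 1)) = 0 := by
      have := (EuclideanSpace.proj i : E →L[ℝ] ℝ).integral_comp_comm
        (IsGaussian.integrable_id (μ := multivariateGaussian (0 : E) (v • 1)))
      simpa using this
    have hv' := variance_eval_multivariateGaussian (μ := (0 : E)) (posSemidef_smul_one hv) i
    rw [variance_of_integral_eq_zero (hcoord i).aemeasurable h0] at hv'
    simpa using hv'
  simp [this]

end IsotropicGaussian

/-! ### Square integrable vector-valued functions -/

section SecondMoments

variable {Ω F : Type*} {mΩ : MeasurableSpace Ω} {P : Measure Ω}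
  [NormedAddCommGroup F] {f g : Ω → F}

lemma MeasureTheory.MemLp.integrable_norm_sq (hf : MemLp f 2 P) :
    Integrable (fun ω => ‖f ω‖ ^ 2) P :=
  (memLp_two_iff_integrable_sq_norm hf.1).1 hf

lemma lintegral_ofReal_norm_sq (hf : MemLp f 2 P) :
    ∫⁻ ω, ENNReal.ofReal (‖f ω‖ ^ 2) ∂P = ENNReal.ofReal (∫ ω, ‖f ω‖ ^ 2 ∂P) :=
  (ofReal_integral_eq_lintegral_ofReal hf.integrable_norm_sq
    (ae_of_all _ fun _ => by positivity)).symm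

lemma memLp_two_of_lintegral_ofReal_norm_sq_ne_top (hf : AEStronglyMeasurable f P)
    (h : ∫⁻ ω, ENNReal.ofReal (‖f ω‖ ^ 2) ∂P ≠ ∞) : MemLp f 2 P :=
  (memLp_two_iff_integrable_sq_norm hf).2
    (lintegral_ofReal_ne_top_iff_integrable (by fun_prop) (ae_of_all _ fun _ => by positivity)
      |>.1 h)

variable [InnerProductSpace ℝ F]

lemma MeasureTheory.MemLp.integrable_inner (hf : MemLp f 2 P) (hg : MemLp g 2 P) :
    Integrable (fun ω => inner ℝ (f ω) (g ω)) P := by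
  refine (hf.integrable_norm_sq.add hg.integrable_norm_sq).mono' (hf.1.inner hg.1)
    (ae_of_all _ fun ω => (norm_inner_le_norm _ _).trans ?_)
  simp only [Pi.add_apply]
  nlinarith [sq_nonneg (‖f ω‖ - ‖g ω‖), sq_nonneg ‖f ω‖, sq_nonneg ‖g ω‖]

lemma integral_norm_add_sq (hf : MemLp f 2 P) (hg : MemLp g 2 P) :
    ∫ ω, ‖f ω + g ω‖ ^ 2 ∂P =
      ∫ ω, ‖f ω‖ ^ 2 ∂P + 2 * ∫ ω, inner ℝ (f ω) (g ω) ∂P + ∫ ω, ‖g ω‖ ^ 2 ∂P := by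
  simp_rw [norm_add_sq_real]
  rw [integral_add (hf.integrable_norm_sq.fun_add ((hf.integrable_inner hg).const_mul 2))
    hg.integrable_norm_sq,
    integral_add hf.integrable_norm_sq ((hf.integrable_inner hg).const_mul 2), integral_const_mul]

end SecondMoments

/-! ### The distortion bound for the additive Gaussian channel -/

section AdditiveGaussianChannel

variable {n : ℕ}

local notation "E" => EuclideanSpace ℝ (Fin n)

/-- The condition `a * b = c * d` makes the normalizing constants agree, so only exponents need to
be exchanged. -/
lemma exp_mul_isotropicGaussianPDF_mul {a b c d : ℝ} (ha : 0 < a) (hb : 0 < b) (hc : 0 < c)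
    (hd : 0 < d) (h : a * b = c * d) (x y z w : E) :
    isotropicGaussianPDF a x * isotropicGaussianPDF b y *
      Real.exp ((2 * a)⁻¹ * ‖x‖ ^ 2 + (2 * b)⁻¹ * ‖y‖ ^ 2 -
        (2 * c)⁻¹ * ‖z‖ ^ 2 - (2 * d)⁻¹ * ‖w‖ ^ 2) =
      isotropicGaussianPDF c z * isotropicGaussianPDF d w := by
  have hmul : ((2 * Real.pi * a) ^ (n / 2 : ℝ))⁻¹ * ((2 * Real.pi * b) ^ (n / 2 : ℝ))⁻¹ =
      ((2 * Real.pi * c) ^ (n / 2 : ℝ))⁻¹ * ((2 * Real.pi * d) ^ (n / 2 : ℝ))⁻¹ := by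
    rw [← mul_inv, ← mul_inv, ← Real.mul_rpow (by positivity) (by positivity),
      ← Real.mul_rpow (by positivity) (by positivity)]
    congr 2
    linear_combination 4 * Real.pi ^ 2 * h
  unfold isotropicGaussianPDF
  rw [mul_mul_mul_comm, ← Real.exp_add, mul_assoc, ← Real.exp_add, hmul, mul_mul_mul_comm,
    ← Real.exp_add]
  congr 2
  ring

/-- The likelihood ratio between the product of the backward Gaussian test channel with the Gaussian
output law and the actual joint law of source and channel output integrates to one. -/
lemma lintegral_exp_gaussian_likelihood_ratio {vm vw d s : ℝ} (hm : 0 < vm) (hw : 0 < vw)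
    (hd : 0 < d) (hs : 0 < s) (h : vm * vw = d * s) {γ δ : E → E}
    (hγ : Measurable γ) (hδ : Measurable δ) :
    ∫⁻ z, ENNReal.ofReal (Real.exp ((2 * vm)⁻¹ * ‖z.1‖ ^ 2 + (2 * vw)⁻¹ * ‖z.2‖ ^ 2 -
        (2 * d)⁻¹ * ‖z.1 - δ (γ z.1 + z.2)‖ ^ 2 - (2 * s)⁻¹ * ‖γ z.1 + z.2‖ ^ 2))
      ∂((multivariateGaussian (0 : E) (vm • 1)).prod (multivariateGaussian (0 : E) (vw • 1))) =
      1 := by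
  rw [multivariateGaussian_smul_one_eq_withDensity hm,
    multivariateGaussian_smul_one_eq_withDensity hw, prod_withDensity (by fun_prop) (by fun_prop),
    lintegral_withDensity_eq_lintegral_mul _ (by fun_prop) (by fun_prop)]
  have hpt : ∀ z : E × E, ((fun z : E × E => ENNReal.ofReal (isotropicGaussianPDF vm z.1) *
      ENNReal.ofReal (isotropicGaussianPDF vw z.2)) * fun z : E × E =>
        ENNReal.ofReal (Real.exp ((2 * vm)⁻¹ * ‖z.1‖ ^ 2 + (2 * vw)⁻¹ * ‖z.2‖ ^ 2 -
        (2 * d)⁻¹ * ‖z.1 - δ (γ z.1 + z.2)‖ ^ 2 - (2 * s)⁻¹ * ‖γ z.1 + z.2‖ ^ 2))) z =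
      ENNReal.ofReal (isotropicGaussianPDF d (z.1 - δ (γ z.1 + z.2))) *
        ENNReal.ofReal (isotropicGaussianPDF s (γ z.1 + z.2)) := by
    intro z
    simp only [Pi.mul_apply]
    rw [← ENNReal.ofReal_mul (isotropicGaussianPDF_nonneg hm _),
      ← ENNReal.ofReal_mul (mul_nonneg (isotropicGaussianPDF_nonneg hm _)
        (isotropicGaussianPDF_nonneg hw _)),
      exp_mul_isotropicGaussianPDF_mul hm hw hd hs h,
      ENNReal.ofReal_mul (isotropicGaussianPDF_nonneg hd _)]
  simp_rw [hpt]
  rw [lintegral_prod _ (by fun_prop)]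
  -- Translation invariance in the noise removes the encoder; after the swap, invariance in the
  -- source removes the decoder.
  have htrans : ∀ x : E, ∫⁻ w, ENNReal.ofReal (isotropicGaussianPDF d (x - δ (γ x + w))) *
      ENNReal.ofReal (isotropicGaussianPDF s (γ x + w)) =
      ∫⁻ y, ENNReal.ofReal (isotropicGaussianPDF d (x - δ y)) *
        ENNReal.ofReal (isotropicGaussianPDF s y) := fun x =>
    lintegral_add_left_eq_self (fun y => ENNReal.ofReal (isotropicGaussianPDF d (x - δ y)) *
        ENNReal.ofReal (isotropicGaussianPDF s y)) (γ x)
  simp_rw [htrans]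
  rw [lintegral_lintegral_swap (by fun_prop)]
  have hinner : ∀ y : E, ∫⁻ x, ENNReal.ofReal (isotropicGaussianPDF d (x - δ y)) *
        ENNReal.ofReal (isotropicGaussianPDF s y) =
        ENNReal.ofReal (isotropicGaussianPDF s y) := by
    intro y
    rw [lintegral_mul_const _ (by fun_prop),
      lintegral_sub_right_eq_self (fun x => ENNReal.ofReal (isotropicGaussianPDF d x)) (δ y),
      lintegral_isotropicGaussianPDF hd, one_mul]
  simp_rw [hinner]
  exact lintegral_isotropicGaussianPDF hs

/-- Isotropic Gaussian source and noise. -/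
noncomputable abbrev gaussianPair (n : ℕ) (vm vw : ℝ) :
    Measure (EuclideanSpace ℝ (Fin n) × EuclideanSpace ℝ (Fin n)) :=
  (multivariateGaussian 0 (vm • 1)).prod (multivariateGaussian 0 (vw • 1))

variable {vm vw : ℝ}

lemma memLp_fst_gaussianPair : MemLp (fun z : E × E => z.1) 2 (gaussianPair n vm vw) :=
  IsGaussian.memLp_two_id.comp_fst _

lemma memLp_snd_gaussianPair : MemLp (fun z : E × E => z.2) 2 (gaussianPair n vm vw) :=
  IsGaussian.memLp_two_id.comp_snd _

lemma integral_norm_sq_fst_gaussianPair (hm : 0 < vm) :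
    ∫ z, ‖z.1‖ ^ 2 ∂(gaussianPair n vm vw) = n * vm := by
  rw [integral_fun_fst (fun x : E => ‖x‖ ^ 2), integral_norm_sq_multivariateGaussian_smul_one hm]
  simp

lemma integral_norm_sq_snd_gaussianPair (hw : 0 < vw) :
    ∫ z, ‖z.2‖ ^ 2 ∂(gaussianPair n vm vw) = n * vw := by
  rw [integral_fun_snd (fun x : E => ‖x‖ ^ 2), integral_norm_sq_multivariateGaussian_smul_one hw]
  simp

lemma integral_fst_gaussianPair : ∫ z, z.1 ∂(gaussianPair n vm vw) = 0 := by
  rw [integral_fun_fst (fun x : E => x)]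
  simp

/-- Integrate over the centred, independent noise first. -/
lemma integral_inner_snd_gaussianPair {γ : E → E}
    (hγ : MemLp (fun z : E × E => γ z.1) 2 (gaussianPair n vm vw)) :
    ∫ z, inner ℝ (γ z.1) z.2 ∂(gaussianPair n vm vw) = 0 := by
  rw [integral_prod _ (hγ.integrable_inner memLp_snd_gaussianPair)]
  have : ∀ x : E, ∫ w, inner ℝ (γ x) w ∂(multivariateGaussian (0 : E) (vw • 1)) = 0 := by
    intro x
    rw [integral_inner (f := fun w : E => w) IsGaussian.integrable_id]
    simp
  simp [this]

lemma integral_norm_sq_channel_output (hw : 0 < vw) {γ : E → E}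
    (hγ : MemLp (fun z : E × E => γ z.1) 2 (gaussianPair n vm vw)) :
    ∫ z, ‖γ z.1 + z.2‖ ^ 2 ∂(gaussianPair n vm vw) =
      ∫ z, ‖γ z.1‖ ^ 2 ∂(gaussianPair n vm vw) + n * vw := by
  rw [integral_norm_add_sq hγ memLp_snd_gaussianPair, integral_inner_snd_gaussianPair hγ,
    integral_norm_sq_snd_gaussianPair hw]
  ring

/-- The distortion of a Gaussian source sent over an additive Gaussian channel with power `n * p` is
at least the distortion-rate function at the channel capacity. -/
theorem distortion_lower_bound (hm : 0 < vm) (hw : 0 < vw) {p : ℝ} (hp : 0 ≤ p) {γ δ : E → E}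
    (hγ : Measurable γ) (hδ : Measurable δ)
    (hγ2 : MemLp (fun z : E × E => γ z.1) 2 (gaussianPair n vm vw))
    (hpow : ∫ z, ‖γ z.1‖ ^ 2 ∂(gaussianPair n vm vw) = n * p)
    (hδ2 : MemLp (fun z : E × E => z.1 - δ (γ z.1 + z.2)) 2 (gaussianPair n vm vw)) :
    n * (vm * vw / (vw + p)) ≤
      ∫ z, ‖z.1 - δ (γ z.1 + z.2)‖ ^ 2 ∂(gaussianPair n vm vw) := by
  have hs : 0 < vw + p := by positivity
  set s := vw + p with hs_def
  -- `s` is the output variance per coordinate; `d` is the claimed minimal distortion, and `d * s =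
  -- vm * vw` cancels the normalizing constants.
  set d := vm * vw / s with hd_def
  have hd : 0 < d := by positivity
  have hds : vm * vw = d * s := by rw [hd_def]; field_simp
  set D := ∫ z, ‖z.1 - δ (γ z.1 + z.2)‖ ^ 2 ∂(gaussianPair n vm vw)
  have hy2 : MemLp (fun z : E × E => γ z.1 + z.2) 2 (gaussianPair n vm vw) :=
    hγ2.add memLp_snd_gaussianPair
  have h1 := lintegral_exp_gaussian_likelihood_ratio hm hw hd hs hds hγ hδ
  set T : E × E → ℝ := fun z => (2 * vm)⁻¹ * ‖z.1‖ ^ 2 + (2 * vw)⁻¹ * ‖z.2‖ ^ 2 -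
        (2 * d)⁻¹ * ‖z.1 - δ (γ z.1 + z.2)‖ ^ 2 - (2 * s)⁻¹ * ‖γ z.1 + z.2‖ ^ 2 with hT
  have i1 := (memLp_fst_gaussianPair (n := n) (vm := vm) (vw := vw)).integrable_norm_sq.const_mul
    (2 * vm)⁻¹
  have i2 := (memLp_snd_gaussianPair (n := n) (vm := vm) (vw := vw)).integrable_norm_sq.const_mul
    (2 * vw)⁻¹
  have i3 := hδ2.integrable_norm_sq.const_mul (2 * d)⁻¹
  have i4 := hy2.integrable_norm_sq.const_mul (2 * s)⁻¹
  have iT : Integrable T (gaussianPair n vm vw) := ((i1.add i2).sub i3).sub i4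
  -- The source and noise terms give `n / 2` each, and the output term takes `n / 2` away.
  have hTval : ∫ z, T z ∂(gaussianPair n vm vw) = n / 2 - (2 * d)⁻¹ * D := by
    have hsplit := integral_sub' ((i1.add i2).sub i3) i4
    rw [integral_sub' (i1.add i2) i3, integral_add' i1 i2] at hsplit
    refine Eq.trans hsplit ?_
    simp only [integral_const_mul]
    rw [integral_norm_sq_fst_gaussianPair hm, integral_norm_sq_snd_gaussianPair hw,
      integral_norm_sq_channel_output hw hγ2, hpow]
    have : (n : ℝ) * p + n * vw = n * s := by rw [hs_def]; ring
    rw [this]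
    field_simp
    ring
  have iexp : Integrable (fun z => Real.exp (T z)) (gaussianPair n vm vw) := by
    refine (lintegral_ofReal_ne_top_iff_integrable ?_
      (ae_of_all _ fun _ => (Real.exp_pos _).le)).1 ?_
    · exact Real.continuous_exp.comp_aestronglyMeasurable iT.1
    · rw [h1]; simp
  have hexp : ∫ z, Real.exp (T z) ∂(gaussianPair n vm vw) = 1 := by
    rw [integral_eq_lintegral_of_nonneg_ae (ae_of_all _ fun _ => (Real.exp_pos _).le) iexp.1, h1]
    simp
  have hle : ∫ z, (T z + 1) ∂(gaussianPair n vm vw) ≤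
      ∫ z, Real.exp (T z) ∂(gaussianPair n vm vw) :=
    integral_mono (iT.add (integrable_const 1)) iexp fun z => Real.add_one_le_exp _
  rw [integral_add iT (integrable_const 1), hexp, hTval] at hle
  simp only [integral_const, probReal_univ, smul_eq_mul, mul_one] at hle
  have h2 : (n : ℝ) / 2 ≤ (2 * d)⁻¹ * D := by linarith
  rw [← div_eq_inv_mul, le_div_iff₀ (by positivity)] at h2
  linarith

end AdditiveGaussianChannel

namespace SignalingGame

variable {n : ℕ} {G : SignalingGame n} {vm vw a : ℝ}

local notation "E" => EuclideanSpace ℝ (Fin n)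

/-! ### Orthogonality for best responses and the encoder's cost -/

section BestResponse

variable {γe γd : EuclideanSpace ℝ (Fin n) → EuclideanSpace ℝ (Fin n)}

lemma decoderCost_eq_ofReal (hlaw : G.law = gaussianPair n vm vw)
    (h : MemLp (fun z : E × E => z.1 - γd (γe z.1 + z.2)) 2 (gaussianPair n vm vw)) :
    G.decoderCost γe γd =
      ENNReal.ofReal (∫ z, ‖z.1 - γd (γe z.1 + z.2)‖ ^ 2 ∂(gaussianPair n vm vw)) := by
  rw [← lintegral_ofReal_norm_sq h, ← hlaw]
  rfl

/-- The zero estimate already has finite cost. -/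
lemma IsBestResponse.memLp_error (hlaw : G.law = gaussianPair n vm vw)
    (hγe : Measurable γe) (h : G.IsBestResponse γe γd) :
    MemLp (fun z : E × E => z.1 - γd (γe z.1 + z.2)) 2 (gaussianPair n vm vw) := by
  have hγd := h.1
  refine memLp_two_of_lintegral_ofReal_norm_sq_ne_top
    (Measurable.aestronglyMeasurable (by fun_prop)) ?_
  have h0 := h.2 (fun _ => 0) measurable_const
  rw [decoderCost_eq_ofReal (γd := fun _ => 0) hlaw (by simpa using memLp_fst_gaussianPair)] at h0
  rw [← hlaw]
  exact ne_top_of_le_ne_top ENNReal.ofReal_ne_top h0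

lemma IsBestResponse.memLp_estimate (hlaw : G.law = gaussianPair n vm vw)
    (hγe : Measurable γe) (h : G.IsBestResponse γe γd) :
    MemLp (fun z : E × E => γd (γe z.1 + z.2)) 2 (gaussianPair n vm vw) := by
  exact (memLp_fst_gaussianPair.sub (h.memLp_error hlaw hγe)).ae_eq
    (ae_of_all _ fun z => sub_sub_cancel _ _)

lemma IsBestResponse.integral_le (hlaw : G.law = gaussianPair n vm vw)
    (hγe : Measurable γe) (h : G.IsBestResponse γe γd) {γd' : E → E} (hγd' : Measurable γd')
    (h' : MemLp (fun z : E × E => z.1 - γd' (γe z.1 + z.2)) 2 (gaussianPair n vm vw)) :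
    ∫ z, ‖z.1 - γd (γe z.1 + z.2)‖ ^ 2 ∂(gaussianPair n vm vw) ≤
      ∫ z, ‖z.1 - γd' (γe z.1 + z.2)‖ ^ 2 ∂(gaussianPair n vm vw) := by
  have hle := h.2 γd' hγd'
  rw [decoderCost_eq_ofReal hlaw (h.memLp_error hlaw hγe), decoderCost_eq_ofReal hlaw h'] at hle
  exact (ENNReal.ofReal_le_ofReal_iff (integral_nonneg fun _ => by positivity)).1 hle

/-- The estimation error of a best response is orthogonal to every square integrable function of the
channel output. -/
lemma IsBestResponse.integral_inner_eq_zero (hlaw : G.law = gaussianPair n vm vw)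
    (hγe : Measurable γe) (h : G.IsBestResponse γe γd) {φ : E → E} (hφ : Measurable φ)
    (hφ2 : MemLp (fun z : E × E => φ (γe z.1 + z.2)) 2 (gaussianPair n vm vw)) :
    ∫ z, inner ℝ (z.1 - γd (γe z.1 + z.2)) (φ (γe z.1 + z.2)) ∂(gaussianPair n vm vw) = 0 := by
  have hγd := h.1
  have hW := h.memLp_error hlaw hγe
  -- Perturbing the estimate by `t • φ` cannot help, so this quadratic without constant term is
  -- nonnegative; its linear coefficient must vanish.
  have hquad : ∀ t : ℝ, 0 ≤ (∫ z, ‖φ (γe z.1 + z.2)‖ ^ 2 ∂(gaussianPair n vm vw)) * (t * t) +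
      (2 * ∫ z, inner ℝ (z.1 - γd (γe z.1 + z.2)) (φ (γe z.1 + z.2)) ∂(gaussianPair n vm vw)) * t
        + 0 := by
    intro t
    have hsub : ∀ z : E × E, z.1 - (γd (γe z.1 + z.2) - t • φ (γe z.1 + z.2)) =
        (z.1 - γd (γe z.1 + z.2)) + t • φ (γe z.1 + z.2) := fun z => by abel
    have hφt : MemLp (fun z : E × E => t • φ (γe z.1 + z.2)) 2 (gaussianPair n vm vw) :=
      hφ2.const_smul t
    have hle := h.integral_le hlaw hγe (γd' := fun y => γd y - t • φ y) (by fun_prop)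
      (by simp_rw [hsub]; exact hW.add hφt)
    simp_rw [hsub] at hle
    rw [integral_norm_add_sq hW hφt] at hle
    simp only [inner_smul_right, integral_const_mul, norm_smul, mul_pow, Real.norm_eq_abs,
      sq_abs] at hle
    linarith
  have hdisc := discrim_le_zero hquad
  rw [discrim] at hdisc
  nlinarith [sq_nonneg (∫ z, inner ℝ (z.1 - γd (γe z.1 + z.2)) (φ (γe z.1 + z.2))
    ∂(gaussianPair n vm vw))]

lemma IsBestResponse.integral_inner_const_eq_zero (hlaw : G.law = gaussianPair n vm vw)
    (hγe : Measurable γe) (h : G.IsBestResponse γe γd) (c : E) :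
    ∫ z, inner ℝ c (γd (γe z.1 + z.2)) ∂(gaussianPair n vm vw) = 0 := by
  have hU := h.memLp_estimate hlaw hγe
  have hc : MemLp (fun _ : E × E => c) 2 (gaussianPair n vm vw) := memLp_const c
  have h1 := h.integral_inner_eq_zero hlaw hγe (φ := fun _ => c) measurable_const hc
  have hm : ∫ z : E × E, inner ℝ c z.1 ∂(gaussianPair n vm vw) = 0 := by
    rw [integral_inner (memLp_fst_gaussianPair.integrable (by norm_num)),
      integral_fst_gaussianPair, inner_zero_right]
  simp_rw [real_inner_comm c, inner_sub_right] at h1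
  rw [integral_sub (hc.integrable_inner memLp_fst_gaussianPair) (hc.integrable_inner hU), hm] at h1
  linarith

/-- Pythagoras: the source is the sum of the error and the estimate, which are orthogonal. -/
lemma IsBestResponse.integral_norm_sq_estimate (hlaw : G.law = gaussianPair n vm vw) (hm : 0 < vm)
    (hγe : Measurable γe) (h : G.IsBestResponse γe γd) :
    ∫ z, ‖γd (γe z.1 + z.2)‖ ^ 2 ∂(gaussianPair n vm vw) =
      n * vm - ∫ z, ‖z.1 - γd (γe z.1 + z.2)‖ ^ 2 ∂(gaussianPair n vm vw) := by
  have hU := h.memLp_estimate hlaw hγe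
  have h1 := integral_norm_add_sq (h.memLp_error hlaw hγe) hU
  rw [h.integral_inner_eq_zero hlaw hγe h.1 hU] at h1
  simp only [sub_add_cancel] at h1
  rw [integral_norm_sq_fst_gaussianPair hm] at h1
  linarith

lemma memLp_encoder_of_encoderCost_ne_top (hlaw : G.law = gaussianPair n vm vw) (hρ : 0 < G.ρ)
    (hγe : Measurable γe) (h : G.encoderCost γe γd ≠ ∞) :
    MemLp (fun z : E × E => γe z.1) 2 (gaussianPair n vm vw) := by
  refine memLp_two_of_lintegral_ofReal_norm_sq_ne_top
    (Measurable.aestronglyMeasurable (by fun_prop)) fun htop => h ?_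
  rw [eq_top_iff]
  calc ∞ = ENNReal.ofReal G.ρ * ∫⁻ z, ENNReal.ofReal (‖γe z.1‖ ^ 2) ∂G.law := by
        rw [hlaw, htop, ENNReal.mul_top (by simpa using hρ)]
    _ = ∫⁻ z, ENNReal.ofReal (G.ρ * ‖γe z.1‖ ^ 2) ∂G.law := by
        rw [← lintegral_const_mul _ (by fun_prop)]
        simp_rw [ENNReal.ofReal_mul hρ.le]
    _ ≤ G.encoderCost γe γd := by
        refine lintegral_mono fun z => ENNReal.ofReal_le_ofReal ?_
        exact le_add_of_nonneg_left (by positivity)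

/-- The encoder's cost under a best response, in terms of the distortion and the power. -/
lemma IsBestResponse.encoderCost_eq (hlaw : G.law = gaussianPair n vm vw) (hm : 0 < vm)
    (hA : G.A = a • (1 : Matrix (Fin n) (Fin n) ℝ)) (hγe : Measurable γe)
    (h : G.IsBestResponse γe γd)
    (hγe2 : MemLp (fun z : E × E => γe z.1) 2 (gaussianPair n vm vw)) :
    G.encoderCost γe γd = ENNReal.ofReal (‖G.b‖ ^ 2 + (a - 1) ^ 2 * (n * vm) +
      (2 * a - 1) * ∫ z, ‖z.1 - γd (γe z.1 + z.2)‖ ^ 2 ∂(gaussianPair n vm vw) +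
      G.ρ * ∫ z, ‖γe z.1‖ ^ 2 ∂(gaussianPair n vm vw)) := by
  have hW := h.memLp_error hlaw hγe
  have hU := h.memLp_estimate hlaw hγe
  have hb : MemLp (fun _ : E × E => -G.b) 2 (gaussianPair n vm vw) := memLp_const _
  have hWb := (hW.const_smul a).add hb
  have hU' := hU.const_smul (a - 1)
  have hWU := h.integral_inner_eq_zero hlaw hγe h.1 hU
  have hbU := h.integral_inner_const_eq_zero hlaw hγe (-G.b)
  have hWbz := h.integral_inner_eq_zero hlaw hγe (φ := fun _ => -G.b) measurable_const hb
  -- Splitting along error, bias and estimate kills all cross terms. The error then carries the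
  -- coefficient a² - (a-1)² = 2a-1.
  have hinst : ∀ z : E × E, G.encoderInstCost z.1 (γe z.1) (γd (γe z.1 + z.2)) =
      ‖(a • (z.1 - γd (γe z.1 + z.2)) + -G.b) + (a - 1) • γd (γe z.1 + z.2)‖ ^ 2 +
        G.ρ * ‖γe z.1‖ ^ 2 := by
    intro z
    rw [encoderInstCost, hA, map_smul, map_one]
    congr 3
    simp only [smul_apply, one_apply_eq_self]
    module
  have hI1 := (hWb.add hU').integrable_norm_sq
  have hI2 := hγe2.integrable_norm_sq.const_mul G.ρ
  have hnonneg : ∀ z : E × E, 0 ≤ G.encoderInstCost z.1 (γe z.1) (γd (γe z.1 + z.2)) := by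
    intro z
    have := G.ρ_nonneg
    unfold encoderInstCost
    positivity
  have hint : ∫ z : E × E, inner ℝ (a • (z.1 - γd (γe z.1 + z.2)) + -G.b)
      ((a - 1) • γd (γe z.1 + z.2)) ∂(gaussianPair n vm vw) = 0 := by
    have hpt : ∀ z : E × E, inner ℝ (a • (z.1 - γd (γe z.1 + z.2)) + -G.b)
        ((a - 1) • γd (γe z.1 + z.2)) =
        (a - 1) * a * inner ℝ (z.1 - γd (γe z.1 + z.2)) (γd (γe z.1 + z.2)) +
          (a - 1) * inner ℝ (-G.b) (γd (γe z.1 + z.2)) := by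
      intro z
      rw [inner_add_left, inner_smul_right, inner_smul_right, inner_smul_left, conj_trivial]
      ring
    simp_rw [hpt]
    rw [integral_add ((hW.integrable_inner hU).const_mul _) ((hb.integrable_inner hU).const_mul _),
      integral_const_mul, integral_const_mul, hWU, hbU]
    ring
  rw [encoderCost, hlaw, ← ofReal_integral_eq_lintegral_ofReal _ (ae_of_all _ hnonneg)]
  · congr 1
    simp_rw [hinst]
    have hsplit := integral_add hI1 hI2
    refine hsplit.trans ?_
    have e1 := integral_norm_add_sq hWb hU'
    have e2 := integral_norm_add_sq (hW.const_smul a) hb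
    have e3 := h.integral_norm_sq_estimate hlaw hm hγe
    simp only [Pi.add_apply, Pi.smul_apply] at e1 e2 ⊢
    rw [e1, e2, hint]
    simp only [inner_smul_left, norm_smul, mul_pow, integral_const_mul, Real.norm_eq_abs, sq_abs,
      norm_neg, integral_const, probReal_univ, e3, hWbz, conj_trivial]
    simp only [smul_eq_mul]
    ring
  · simp_rw [hinst]
    exact hI1.add hI2

end BestResponse

end SignalingGame

namespace SignalingGame

variable {n : ℕ} {G : SignalingGame n} {vm vw a : ℝ}

local notation "E" => EuclideanSpace ℝ (Fin n)

/-! ### Linear policies attain the distortion bound -/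

section LinearPolicies

lemma integral_norm_sq_linear_encoder (hm : 0 < vm) (α : ℝ) :
    ∫ z : E × E, ‖α • z.1‖ ^ 2 ∂(gaussianPair n vm vw) = n * (α ^ 2 * vm) := by
  simp_rw [norm_smul, mul_pow, integral_const_mul, Real.norm_eq_abs, sq_abs]
  rw [integral_norm_sq_fst_gaussianPair hm]
  ring

lemma memLp_linear_encoder (α : ℝ) :
    MemLp (fun z : E × E => α • z.1) 2 (gaussianPair n vm vw) :=
  memLp_fst_gaussianPair.const_smul α

lemma memLp_linear_error (α k : ℝ) :
    MemLp (fun z : E × E => z.1 - k • (α • z.1 + z.2)) 2 (gaussianPair n vm vw) :=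
  memLp_fst_gaussianPair.sub
    (((memLp_linear_encoder α).add memLp_snd_gaussianPair).const_smul k)

lemma integral_norm_sq_linear_error (hm : 0 < vm) (hw : 0 < vw) (α : ℝ) :
    ∫ z : E × E, ‖z.1 - (α * vm / (vw + α ^ 2 * vm)) • (α • z.1 + z.2)‖ ^ 2
      ∂(gaussianPair n vm vw) = n * (vm * vw / (vw + α ^ 2 * vm)) := by
  set k := α * vm / (vw + α ^ 2 * vm) with hk
  have hX : MemLp (fun z : E × E => (1 - k * α) • z.1) 2 (gaussianPair n vm vw) :=
    memLp_linear_encoder _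
  have hY : MemLp (fun z : E × E => (-k) • z.2) 2 (gaussianPair n vm vw) :=
    memLp_snd_gaussianPair.const_smul (-k)
  have hpt : ∀ z : E × E, z.1 - k • (α • z.1 + z.2) = (1 - k * α) • z.1 + (-k) • z.2 := by
    intro z; module
  simp_rw [hpt]
  rw [integral_norm_add_sq hX hY, integral_norm_sq_linear_encoder hm]
  simp_rw [inner_smul_right, norm_smul, mul_pow, integral_const_mul]
  rw [integral_inner_snd_gaussianPair (γ := fun x => (1 - k * α) • x) hX,
    integral_norm_sq_snd_gaussianPair hw, Real.norm_eq_abs, sq_abs, hk]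
  have hs : vw + α ^ 2 * vm ≠ 0 := by positivity
  field_simp
  ring

/-- The linear estimator's error equals the lower bound at power `α ^ 2 * vm`, so no measurable
decoder does better. -/
lemma isBestResponse_linear (hlaw : G.law = gaussianPair n vm vw) (hm : 0 < vm) (hw : 0 < vw)
    (α : ℝ) :
    G.IsBestResponse (fun x => α • x) (fun y => (α * vm / (vw + α ^ 2 * vm)) • y) := by
  refine ⟨by fun_prop, fun γd' hγd' => ?_⟩
  rw [decoderCost_eq_ofReal hlaw (memLp_linear_error α _), integral_norm_sq_linear_error hm hw]
  by_cases hfin : G.decoderCost (fun x => α • x) γd' = ∞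
  · simp [hfin]
  have herr : MemLp (fun z : E × E => z.1 - γd' (α • z.1 + z.2)) 2 (gaussianPair n vm vw) := by
    refine memLp_two_of_lintegral_ofReal_norm_sq_ne_top
      (Measurable.aestronglyMeasurable (by fun_prop)) ?_
    rw [← hlaw]
    exact hfin
  rw [decoderCost_eq_ofReal hlaw herr]
  exact ENNReal.ofReal_le_ofReal (distortion_lower_bound hm hw (by positivity)
    (measurable_const_smul α) hγd' (memLp_linear_encoder α)
    (integral_norm_sq_linear_encoder hm α) herr)

lemma encoderCost_linear (hlaw : G.law = gaussianPair n vm vw) (hm : 0 < vm) (hw : 0 < vw)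
    (hA : G.A = a • (1 : Matrix (Fin n) (Fin n) ℝ)) (α : ℝ) :
    G.encoderCost (fun x => α • x) (fun y => (α * vm / (vw + α ^ 2 * vm)) • y) =
      ENNReal.ofReal (‖G.b‖ ^ 2 + (a - 1) ^ 2 * (n * vm) +
        (2 * a - 1) * (n * (vm * vw / (vw + α ^ 2 * vm))) + G.ρ * (n * (α ^ 2 * vm))) := by
  rw [(isBestResponse_linear hlaw hm hw α).encoderCost_eq hlaw hm hA (measurable_const_smul α)
    (memLp_linear_encoder α), integral_norm_sq_linear_error hm hw,
    integral_norm_sq_linear_encoder hm]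

/-- The first coordinates of source and message have covariance `α * vm`, which is nonzero. -/
lemma isInformative_linear (hn : 1 ≤ n) (hlaw : G.law = gaussianPair n vm vw) (hm : 0 < vm)
    {α : ℝ} (hα : α ≠ 0) : G.IsInformative (fun x => α • x) := by
  intro hind
  rw [hlaw] at hind
  have hmem : MemLp (fun x : E => x ⟨0, hn⟩) 2 (multivariateGaussian (0 : E) (vm • 1)) :=
    IsGaussian.memLp_two_id.continuousLinearMap_comp (EuclideanSpace.proj ⟨0, hn⟩ : E →L[ℝ] ℝ)
  have hmem' : MemLp (fun z : E × E => z.1 ⟨0, hn⟩) 2 (gaussianPair n vm vw) := hmem.comp_fst _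
  have hcomp : IndepFun (fun z : E × E => z.1 ⟨0, hn⟩) (fun z : E × E => α * z.1 ⟨0, hn⟩)
      (gaussianPair n vm vw) :=
    hind.comp (φ := fun x : E => x ⟨0, hn⟩) (ψ := fun x : E => x ⟨0, hn⟩) (by fun_prop)
      (by fun_prop)
  have hcov := hcomp.covariance_eq_zero hmem' (hmem'.const_mul α)
  rw [covariance_const_mul_right, covariance_self hmem'.aemeasurable] at hcov
  have hvar : Var[fun z : E × E => z.1 ⟨0, hn⟩; gaussianPair n vm vw] = vm := by
    have h1 := variance_eval_multivariateGaussian (μ := (0 : E)) (posSemidef_smul_one hm) ⟨0, hn⟩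
    rw [← Measure.fst_prod (μ := multivariateGaussian (0 : E) (vm • 1))
      (ν := multivariateGaussian (0 : E) (vw • 1)), Measure.fst, variance_map
      (Measurable.aemeasurable (by fun_prop)) (by fun_prop)] at h1
    exact h1.trans (by simp)
  rw [hvar] at hcov
  exact mul_ne_zero hα hm.ne' hcov

lemma isAffinePolicy_smul (k : ℝ) : IsAffinePolicy (fun x : E => k • x) :=
  ⟨k • 1, 0, fun v => by simp⟩

end LinearPolicies

/-! ### The trade-off between power and distortion -/

/-- Distortion and power of an encoder policy of finite cost under a best response. -/
lemma IsBestResponse.exists_power_distortion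
    {γe γd : EuclideanSpace ℝ (Fin n) → EuclideanSpace ℝ (Fin n)} (hn : 1 ≤ n)
    (hlaw : G.law = gaussianPair n vm vw)
    (hm : 0 < vm) (hw : 0 < vw) (hA : G.A = a • (1 : Matrix (Fin n) (Fin n) ℝ))
    (hρ : 0 < G.ρ) (hγe : Measurable γe) (h : G.IsBestResponse γe γd)
    (hfin : G.encoderCost γe γd ≠ ∞) :
    ∃ p D : ℝ, 0 ≤ p ∧ vm * vw / (vw + p) ≤ D ∧ D ≤ vm ∧
      (p = 0 → ∀ᵐ z ∂G.law, γe z.1 = 0) ∧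
      G.encoderCost γe γd = ENNReal.ofReal (‖G.b‖ ^ 2 + (a - 1) ^ 2 * (n * vm) +
        (2 * a - 1) * (n * D) + G.ρ * (n * p)) := by
  have hn' : (0 : ℝ) < n := by exact_mod_cast hn
  have hγe2 := memLp_encoder_of_encoderCost_ne_top hlaw hρ hγe hfin
  have hW := h.memLp_error hlaw hγe
  have hP : 0 ≤ ∫ z : E × E, ‖γe z.1‖ ^ 2 ∂(gaussianPair n vm vw) :=
    integral_nonneg fun _ => by positivity
  refine ⟨(∫ z : E × E, ‖γe z.1‖ ^ 2 ∂(gaussianPair n vm vw)) / n,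
    (∫ z : E × E, ‖z.1 - γd (γe z.1 + z.2)‖ ^ 2 ∂(gaussianPair n vm vw)) / n,
    by positivity, ?_, ?_, ?_, ?_⟩
  · rw [le_div_iff₀' hn']
    exact distortion_lower_bound hm hw (by positivity) hγe h.1 hγe2
      (by field_simp) hW
  · rw [div_le_iff₀' hn', ← integral_norm_sq_fst_gaussianPair (vw := vw) hm]
    simpa using h.integral_le hlaw hγe (γd' := fun _ => 0) measurable_const
      (by simpa using memLp_fst_gaussianPair)
  · intro h0
    rw [div_eq_zero_iff, or_iff_left hn'.ne', integral_eq_zero_iff_of_nonneg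
      (fun _ => by positivity) hγe2.integrable_norm_sq] at h0
    rw [hlaw]
    filter_upwards [h0] with z hz
    simpa using hz
  · rw [h.encoderCost_eq hlaw hm hA hγe hγe2, mul_div_cancel₀ _ hn'.ne',
      mul_div_cancel₀ _ hn'.ne']

lemma lt_of_isStackelbergEquilibrium_of_isInformative
    {γe γd : EuclideanSpace ℝ (Fin n) → EuclideanSpace ℝ (Fin n)} (hn : 1 ≤ n)
    (hlaw : G.law = gaussianPair n vm vw)
    (hm : 0 < vm) (hw : 0 < vw) (hA : G.A = a • (1 : Matrix (Fin n) (Fin n) ℝ))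
    (hρ : 0 < G.ρ) (h : G.IsStackelbergEquilibrium γe γd) (hinf : G.IsInformative γe) :
    G.ρ < (2 * a - 1) * (vm / vw) := by
  have hn' : (0 : ℝ) < n := by exact_mod_cast hn
  obtain ⟨hγe, hbr, hopt⟩ := h
  have hprob : IsProbabilityMeasure G.law := by rw [hlaw]; infer_instance
  -- Compare with the silent encoder.
  have hle := hopt _ _ (measurable_const_smul (0 : ℝ)) (isBestResponse_linear hlaw hm hw 0)
  rw [encoderCost_linear hlaw hm hw hA] at hle
  obtain ⟨p, D, hp, hD, hDm, hp0, hcost⟩ := hbr.exists_power_distortion hn hlaw hm hw hA hρ hγe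
    (ne_top_of_le_ne_top ENNReal.ofReal_ne_top hle)
  have hp' : 0 < p := by
    refine lt_of_le_of_ne hp fun h0 => hinf ?_
    exact (indepFun_const_right _ (0 : E)).congr Filter.EventuallyEq.rfl
      ((hp0 h0.symm).mono fun z hz => hz.symm)
  have hzero : ‖G.b‖ ^ 2 + (a - 1) ^ 2 * (n * vm) +
        (2 * a - 1) * (n * (vm * vw / (vw + 0 ^ 2 * vm))) + G.ρ * (n * (0 ^ 2 * vm)) =
        ‖G.b‖ ^ 2 + (a ^ 2) * (n * vm) := by
    field_simp
    ring
  rw [hcost, hzero, ENNReal.ofReal_le_ofReal_iff (by positivity)] at hle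
  have h1 : G.ρ * p ≤ (2 * a - 1) * (vm - D) := by
    refine le_of_mul_le_mul_left ?_ hn'
    linarith
  have h2 : 0 < 2 * a - 1 := by
    by_contra hcon
    nlinarith [mul_pos hρ hp', mul_nonneg (sub_nonneg.2 hDm) (sub_nonneg.2 (not_lt.1 hcon))]
  -- The bound on the distortion reduction is strictly concave in the power, so it lies below its
  -- tangent at 0; hence the strict inequality.
  have h3 : vm - D < vm / vw * p := by
    have : vm - vm * vw / (vw + p) < vm / vw * p := by
      have : vm / vw * p - (vm - vm * vw / (vw + p)) = vm * p ^ 2 / (vw * (vw + p)) := by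
        field_simp
        ring
      have : 0 < vm * p ^ 2 / (vw * (vw + p)) := by positivity
      linarith
    linarith
  refine lt_of_mul_lt_mul_right ?_ hp
  calc G.ρ * p ≤ (2 * a - 1) * (vm - D) := h1
    _ < (2 * a - 1) * (vm / vw * p) := mul_lt_mul_of_pos_left h3 h2
    _ = (2 * a - 1) * (vm / vw) * p := by ring

lemma exists_isStackelbergEquilibrium_linear (hn : 1 ≤ n) (hlaw : G.law = gaussianPair n vm vw)
    (hm : 0 < vm) (hw : 0 < vw) (hA : G.A = a • (1 : Matrix (Fin n) (Fin n) ℝ))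
    (hρ : 0 < G.ρ) (h : G.ρ < (2 * a - 1) * (vm / vw)) :
    ∃ α k : ℝ, α ≠ 0 ∧
      G.IsStackelbergEquilibrium (fun x => α • x) (fun y => k • y) := by
  have ha : 0 < 2 * a - 1 := by
    by_contra hcon
    have : 0 < vm / vw := by positivity
    nlinarith
  -- `s` minimizes (2a-1) vm vw/s + ρs, where s = vw + p is the output variance. The hypothesis says
  -- exactly that s > vw, so the power s - vw is positive.
  set s := Real.sqrt ((2 * a - 1) * (vm * vw) / G.ρ) with hs_def
  have hs2 : G.ρ * s ^ 2 = (2 * a - 1) * (vm * vw) := by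
    rw [hs_def, Real.sq_sqrt (by positivity)]
    field_simp
  have hs : vw < s := by
    rw [hs_def, Real.lt_sqrt hw.le, lt_div_iff₀ hρ]
    rw [← mul_div_assoc, lt_div_iff₀ hw] at h
    nlinarith
  have hs0 : 0 < s := hw.trans hs
  have hα : 0 < (s - vw) / vm := div_pos (sub_pos.2 hs) hm
  have hα2 : Real.sqrt ((s - vw) / vm) ^ 2 * vm = s - vw := by
    rw [Real.sq_sqrt hα.le, div_mul_cancel₀ _ hm.ne']
  refine ⟨Real.sqrt ((s - vw) / vm), _, (Real.sqrt_pos.2 hα).ne', measurable_const_smul _,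
    isBestResponse_linear hlaw hm hw _, fun γe' γd' hγe' hbr => ?_⟩
  by_cases hfin : G.encoderCost γe' γd' = ∞
  · simp [hfin]
  obtain ⟨p, D, hp, hD, -, -, hcost⟩ := hbr.exists_power_distortion hn hlaw hm hw hA hρ hγe' hfin
  rw [hcost, encoderCost_linear hlaw hm hw hA, hα2]
  refine ENNReal.ofReal_le_ofReal ?_
  have hkey : (2 * a - 1) * (vm * vw / s) + G.ρ * (s - vw) ≤ (2 * a - 1) * D + G.ρ * p := by
    have h1 : (2 * a - 1) * (vm * vw / (vw + p)) ≤ (2 * a - 1) * D :=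
      mul_le_mul_of_nonneg_left hD ha.le
    rw [← mul_div_assoc, ← hs2] at h1 ⊢
    -- The excess over the minimum is a completed square.
    have h2 : G.ρ * s ^ 2 / (vw + p) + G.ρ * p - (G.ρ * s ^ 2 / s + G.ρ * (s - vw)) =
        G.ρ * (vw + p - s) ^ 2 / (vw + p) := by
      field_simp
      ring
    have h3 : 0 ≤ G.ρ * (vw + p - s) ^ 2 / (vw + p) := by positivity
    linarith
  have := mul_le_mul_of_nonneg_left hkey (Nat.cast_nonneg (α := ℝ) n)
  rw [add_sub_cancel]
  linarith

end SignalingGame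

theorem mainTheorem7 {n : ℕ} (hn : 1 ≤ n) (G : SignalingGame n)
    (σm σw a : ℝ) (hσm : 0 < σm) (hσw : 0 < σw)
    (hm : G.sourceCov = σm ^ 2 • (1 : Matrix (Fin n) (Fin n) ℝ))
    (hw : G.noiseCov = σw ^ 2 • (1 : Matrix (Fin n) (Fin n) ℝ))
    (hA : G.A = a • (1 : Matrix (Fin n) (Fin n) ℝ))
    (hρ : 0 < G.ρ) :
    ((∃ γe γd : EuclideanSpace ℝ (Fin n) → EuclideanSpace ℝ (Fin n),
        G.IsStackelbergEquilibrium γe γd ∧ IsAffinePolicy γe ∧ IsAffinePolicy γd ∧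
          G.IsInformative γe) ↔
      G.ρ < (2 * a - 1) * (σm ^ 2 / σw ^ 2)) ∧
    ((∃ γe γd : EuclideanSpace ℝ (Fin n) → EuclideanSpace ℝ (Fin n),
        G.IsStackelbergEquilibrium γe γd ∧ G.IsInformative γe) ↔
      G.ρ < (2 * a - 1) * (σm ^ 2 / σw ^ 2)) := by
  have hlaw : G.law = gaussianPair n (σm ^ 2) (σw ^ 2) := by
    rw [SignalingGame.law, hm, hw]
  have hm' : 0 < σm ^ 2 := by positivity
  have hw' : 0 < σw ^ 2 := by positivity
  have hexists : G.ρ < (2 * a - 1) * (σm ^ 2 / σw ^ 2) →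
      ∃ γe γd : EuclideanSpace ℝ (Fin n) → EuclideanSpace ℝ (Fin n),
        G.IsStackelbergEquilibrium γe γd ∧ IsAffinePolicy γe ∧ IsAffinePolicy γd ∧
          G.IsInformative γe := by
    intro h
    obtain ⟨α, k, hα, heq⟩ :=
      SignalingGame.exists_isStackelbergEquilibrium_linear hn hlaw hm' hw' hA hρ h
    exact ⟨_, _, heq, SignalingGame.isAffinePolicy_smul α, SignalingGame.isAffinePolicy_smul k,
      SignalingGame.isInformative_linear hn hlaw hm' hα⟩
  refine ⟨⟨?_, hexists⟩, ⟨?_, fun h => ?_⟩⟩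
  · rintro ⟨γe, γd, heq, -, -, hinf⟩
    exact SignalingGame.lt_of_isStackelbergEquilibrium_of_isInformative hn hlaw hm' hw' hA hρ
      heq hinf
  · rintro ⟨γe, γd, heq, hinf⟩
    exact SignalingGame.lt_of_isStackelbergEquilibrium_of_isInformative hn hlaw hm' hw' hA hρ
      heq hinf
  · obtain ⟨γe, γd, heq, -, -, hinf⟩ := hexists h
    exact ⟨γe, γd, heq, hinf⟩
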